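/- Let $m\ge 1$ be an integer and let $G$ be a finite loopless graph with at least one vertex (multiple edges are allowed). For $S\subseteq V(G)$ let $G\setminus S$ be the graph obtained by deleting the vertices of $S$, and for a graph $F$ let $\mathrm{iso}(F)$ and $\omega(F)$ denote the number of isolated vertices and the number of connected components of $F$, respectively. A graph is $m$-tree-connected if it has $m$ pairwise edge-disjoint spanning trees, and a factor of $G$ is a spanning subgraph of $G$. Suppose that for every $S\subseteq V(G)$, $$\frac{m+1}{2}\,\mathrm{iso}(G\setminus S)+\omega(G\setminus S)\le \frac{1}{m}|S|+1.$$ Then for every vertex $u$ of $G$, the graph $G$ has an $m$-tree-connected factor $H$ such that $d_H(v)\le 2m+1$ for every vertex $v$, and moreover $d_H(u)\le m+1$, where $d_H(v)$ is the number of edges of $H$ incident with $v$. -/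

import Mathlib

open scoped Graph

namespace Graph

/-- The number `ω(G)` of connected components of a multigraph: adjacency, hence connectedness, only
depends on the underlying simple graph on `V(G)`. -/
noncomputable def numComponents {α β : Type*} (G : Graph α β) : ℕ :=
  Nat.card G.toSimpleGraph.ConnectedComponent

/-- The number `iso(G)` of isolated vertices of a multigraph, i.e. of vertices of `G` that have no
neighbour. -/
noncomputable def numIsolated {α β : Type*} (G : Graph α β) : ℕ :=
  {v | v ∈ V(G) ∧ ∀ w, ¬ G.Adj v w}.ncard

/-- The degree of a vertex in a loopless multigraph: the number of edges incident with it, parallel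
edges being counted separately. -/
noncomputable def degree {α β : Type*} (G : Graph α β) (v : α) : ℕ :=
  (G.incidenceSet v).ncard

/-- A multigraph is a tree if it has no loops, no parallel edges, and is a tree as a simple graph
(connected, with at least one vertex, and without cycles). -/
def IsTree {α β : Type*} (G : Graph α β) : Prop :=
  G.Simple ∧ G.toSimpleGraph.IsTree

/-- A multigraph is `m`-tree-connected if it has `m` pairwise edge-disjoint spanning trees. -/
def IsTreeConnected {α β : Type*} (G : Graph α β) (m : ℕ) : Prop :=
  ∃ T : Fin m → Graph α β,
    (∀ i, T i ≤s G ∧ (T i).IsTree) ∧ ∀ i j, i ≠ j → Disjoint E(T i) E(T j)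

end Graph

/-! Call an edge set sparse if every nonempty vertex set `X` spans at most `m (|X| - 1)` of its
edges, and `X` tight if equality holds. A sparse set splits into `m` forests
(`Sparse.exists_coloring`), and if it has `m (|V| - 1)` edges these are spanning trees. So a
full-size sparse set with small degrees is wanted.

Intersecting tight sets are closed under union and intersection, and this governs all exchanges.
`exists_sparse_deg_le` takes a full-size sparse set of least total excess over degree bounds `g`. If
excess remains, the offending vertices are enclosed in a maximal locked set `S`: each tight set
meeting `S` has a vertex of `S` whose degree cannot drop inside it without adding excess. Then every
unused edge off `S` lies in a tight set avoiding `S` (`Locked.exists_tight`), and the maximal tight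
subsets of `V \ S` form a partition with too many blocks for its cross edges.

Toughness forbids this: `card_image_le_of_tough` gives `m * blocks ≤ |S| + m + cross edges`.
Vertices move into `S` until cross edges join only singleton blocks; among these a Caro–Wei
independent set (`exists_independent`) becomes the isolated vertices, which is where the coefficient
`(m + 1) / 2` enters. The bounds `2m + 1`, with one vertex lowered by `m`, use up the slack. -/

namespace SparseEdges

open Finset

set_option linter.unusedSectionVars false

variable {α β : Type*} [DecidableEq α] [DecidableEq β] {p : β → α × α} {m : ℕ}

/-! ### Sparse and tight sets: uncrossing, exchange, partition into tight sets. -/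

section

variable {H K : Finset β} {X Y Z T : Finset α} {e f : β}

/-- The edges of `H` with both ends in `X`, where `p` gives the ends of an edge. -/
def inside (p : β → α × α) (H : Finset β) (X : Finset α) : Finset β :=
  H.filter fun e => (p e).1 ∈ X ∧ (p e).2 ∈ X

/-- Every nonempty set `X` of vertices spans at most `m (|X| - 1)` edges of `H`. -/
def Sparse (p : β → α × α) (m : ℕ) (H : Finset β) : Prop :=
  ∀ X : Finset α, X.Nonempty → #(inside p H X) + m ≤ m * #X

/-- The nonempty set `X` spans exactly `m (|X| - 1)` edges of `H`. -/
def Tight (p : β → α × α) (m : ℕ) (H : Finset β) (X : Finset α) : Prop :=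
  X.Nonempty ∧ #(inside p H X) + m = m * #X

lemma mem_inside : e ∈ inside p H X ↔ e ∈ H ∧ (p e).1 ∈ X ∧ (p e).2 ∈ X := by
  simp [inside]

lemma inside_subset : inside p H X ⊆ H := filter_subset _ _

lemma inside_mono_left (h : H ⊆ K) : inside p H X ⊆ inside p K X := filter_subset_filter _ h

lemma inside_mono_right (h : X ⊆ Y) : inside p H X ⊆ inside p H Y := fun e he => by
  rw [mem_inside] at *
  exact ⟨he.1, h he.2.1, h he.2.2⟩

lemma inside_congr (h : ∀ e, (p e).1 ∈ X → (p e).2 ∈ X → (e ∈ H ↔ e ∈ K)) :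
    inside p H X = inside p K X := by
  ext e
  simp only [mem_inside]
  constructor
  · rintro ⟨h1, h2, h3⟩; exact ⟨(h e h2 h3).1 h1, h2, h3⟩
  · rintro ⟨h1, h2, h3⟩; exact ⟨(h e h2 h3).2 h1, h2, h3⟩

lemma Sparse.mono (hK : Sparse p m K) (h : H ⊆ K) : Sparse p m H := fun X hX =>
  (Nat.add_le_add_right (card_le_card (inside_mono_left h)) m).trans (hK X hX)

lemma sparse_empty : Sparse p m ∅ := fun X hX => by
  have : 1 ≤ #X := hX.card_pos
  simpa [inside] using Nat.mul_le_mul_left m this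

lemma card_inside_add_le :
    #(inside p H X) + #(inside p H Y) ≤ #(inside p H (X ∪ Y)) + #(inside p H (X ∩ Y)) := by
  rw [← card_union_add_card_inter]
  refine Nat.add_le_add (card_le_card fun e he => ?_) (card_le_card fun e he => ?_)
  · simp only [mem_union, mem_inside] at *
    tauto
  · simp only [mem_inter, mem_inside] at *
    tauto

/-- Uncrossing: the number of spanned edges is supermodular while `m (|X| - 1)` is modular, so both
sparsity bounds must be attained. -/
lemma Sparse.tight_union_inter (hH : Sparse p m H) (hX : Tight p m H X) (hY : Tight p m H Y)
    (h : (X ∩ Y).Nonempty) : Tight p m H (X ∪ Y) ∧ Tight p m H (X ∩ Y) := by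
  have h1 := card_inside_add_le (p := p) (H := H) (X := X) (Y := Y)
  have hu : (X ∪ Y).Nonempty := hX.1.mono subset_union_left
  have h2 := hH _ hu
  have h3 := hH _ h
  have h4 := congrArg (m * ·) (card_union_add_card_inter X Y)
  simp only [mul_add] at h4
  have h5 := hX.2
  have h6 := hY.2
  exact ⟨⟨hu, by omega⟩, ⟨h, by omega⟩⟩

lemma Sparse.tight_union (hH : Sparse p m H) (hX : Tight p m H X) (hY : Tight p m H Y)
    {v : α} (hvX : v ∈ X) (hvY : v ∈ Y) : Tight p m H (X ∪ Y) :=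
  (hH.tight_union_inter hX hY ⟨v, mem_inter.2 ⟨hvX, hvY⟩⟩).1

lemma Sparse.tight_singleton (hH : Sparse p m H) (v : α) : Tight p m H {v} := by
  refine ⟨singleton_nonempty v, ?_⟩
  have := hH {v} (singleton_nonempty v)
  simp only [card_singleton, mul_one] at *
  omega

/-- A smallest tight set containing two given vertices. -/
lemma Sparse.exists_minimal_tight (hH : Sparse p m H) (hX : Tight p m H X) {x y : α}
    (hx : x ∈ X) (hy : y ∈ X) :
    ∃ T, Tight p m H T ∧ x ∈ T ∧ y ∈ T ∧ ∀ Y, Tight p m H Y → x ∈ Y → y ∈ Y → T ⊆ Y := by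
  classical
  obtain ⟨T, hT, hmin⟩ := exists_min_image
    (X.powerset.filter fun T => Tight p m H T ∧ x ∈ T ∧ y ∈ T) card
    ⟨X, by simp [hX, hx, hy]⟩
  simp only [mem_filter, mem_powerset] at hT hmin
  refine ⟨T, hT.2.1, hT.2.2.1, hT.2.2.2, fun Y hY hxY hyY => ?_⟩
  have := (hH.tight_union_inter hT.2.1 hY ⟨x, mem_inter.2 ⟨hT.2.2.1, hxY⟩⟩).2
  have h := hmin (T ∩ Y) ⟨inter_subset_left.trans hT.1, this,
    mem_inter.2 ⟨hT.2.2.1, hxY⟩, mem_inter.2 ⟨hT.2.2.2, hyY⟩⟩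
  exact inter_eq_left.1 (eq_of_subset_of_card_le inter_subset_left h)

lemma inside_insert_of_not (h : ¬((p e).1 ∈ X ∧ (p e).2 ∈ X)) :
    inside p (insert e H) X = inside p H X := by
  simp [inside, filter_insert, h]

lemma inside_insert (h : (p e).1 ∈ X ∧ (p e).2 ∈ X) :
    inside p (insert e H) X = insert e (inside p H X) := by
  simp [inside, filter_insert, h]

lemma Sparse.insert_sparse (hH : Sparse p m H)
    (h : ∀ X, Tight p m H X → ¬((p e).1 ∈ X ∧ (p e).2 ∈ X)) : Sparse p m (insert e H) := by
  intro X hX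
  by_cases he : (p e).1 ∈ X ∧ (p e).2 ∈ X
  · have h1 := hH X hX
    have h2 : #(inside p H X) + m ≠ m * #X := fun h' => h X ⟨hX, h'⟩ he
    have h3 := card_insert_le e (inside p H X)
    rw [inside_insert he]
    omega
  · rw [inside_insert_of_not he]
    exact hH X hX

lemma Sparse.exists_tight_of_not_sparse_insert (hH : Sparse p m H)
    (h : ¬Sparse p m (insert e H)) : ∃ X, Tight p m H X ∧ (p e).1 ∈ X ∧ (p e).2 ∈ X := by
  by_contra! h'
  exact h (hH.insert_sparse fun X hX hX' => h' X hX hX'.1 hX'.2)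

/-- An edge inside the smallest tight set containing the ends of `e` can be exchanged for `e`. -/
lemma Sparse.exchange (hH : Sparse p m H)
    (hT : ∀ Y, Tight p m H Y → (p e).1 ∈ Y → (p e).2 ∈ Y → T ⊆ Y) (hf : f ∈ inside p H T) :
    Sparse p m (insert e (H.erase f)) := by
  refine (hH.mono (erase_subset _ _)).insert_sparse fun X hX he => ?_
  have hsub : inside p (H.erase f) X ⊆ inside p H X := inside_mono_left (erase_subset _ _)
  have h1 := hX.2
  have h2 := hH X hX.1
  -- A set blocking `e` after deleting `f` was already tight in `H`, so it contains `T` and hence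
  -- `f`; but then deleting `f` would have cost it an edge.
  have heq : inside p (H.erase f) X = inside p H X :=
    eq_of_subset_of_card_le hsub (by omega)
  have hXT : Tight p m H X := ⟨hX.1, by rw [← heq]; exact h1⟩
  have hfX : f ∈ inside p H X := inside_mono_right (hT X hXT he.1 he.2) hf
  rw [← heq, mem_inside] at hfX
  exact notMem_erase f H hfX.1

/-- Otherwise `T \ {z}`, which still contains `x`, would span all `m (|T| - 1)` edges, too many for
its size. -/
lemma Sparse.exists_incident (hH : Sparse p m H) (hm : 1 ≤ m) (hT : Tight p m H T) {x z : α}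
    (hx : x ∈ T) (hz : z ∈ T) (hxz : x ≠ z) :
    ∃ f ∈ inside p H T, (p f).1 = z ∨ (p f).2 = z := by
  by_contra! h
  have h1 := hH (T.erase z) ⟨x, mem_erase.2 ⟨hxz, hx⟩⟩
  have h2 : inside p H T ⊆ inside p H (T.erase z) := fun f hf => by
    have := h f hf
    simp only [mem_inside, mem_erase] at *
    tauto
  have h3 := card_le_card h2
  have h4 := hT.2
  have h5 := card_erase_add_one hz
  rw [← h5, mul_add] at h4
  omega

/-- Replacing the part of a sparse edge set inside a tight set by another sparse edge set. -/
lemma Sparse.replace (hH : Sparse p m H) (hZ : Tight p m H Z) (hK : Sparse p m K) :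
    Sparse p m (H \ inside p H Z ∪ inside p K Z) := by
  intro X hX
  by_cases hXZ : (X ∩ Z).Nonempty
  · have h1 := card_inside_add_le (p := p) (H := H) (X := X) (Y := Z)
    have h2 := hH (X ∪ Z) (hX.mono subset_union_left)
    have h3 := hK _ hXZ
    have h4 := congrArg (m * ·) (card_union_add_card_inter X Z)
    simp only [mul_add] at h4
    have h5 := hZ.2
    -- Supermodularity with the tight `Z` gives at most `m (|X| - |X ∩ Z|)` edges of `H` inside `X`
    -- but not inside `Z`; the sparse `K` adds at most `m (|X ∩ Z| - 1)`.
    have h6 : inside p (H \ inside p H Z ∪ inside p K Z) X ⊆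
        (inside p H X \ inside p H (X ∩ Z)) ∪ inside p K (X ∩ Z) := fun e he => by
      simp only [mem_inside, mem_union, mem_sdiff, mem_inter] at *
      tauto
    have h7 := (card_le_card h6).trans (card_union_le _ _)
    rw [card_sdiff_of_subset (inside_mono_right inter_subset_left)] at h7
    have h8 : #(inside p H (X ∩ Z)) ≤ #(inside p H X) :=
      card_le_card (inside_mono_right inter_subset_left)
    omega
  · refine le_trans (Nat.add_le_add_right (card_le_card fun e he => ?_) m) (hH X hX)
    rw [not_nonempty_iff_eq_empty] at hXZ
    have : ∀ v, v ∈ X → v ∉ Z := fun v hv hv' => by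
      have : v ∈ X ∩ Z := mem_inter.2 ⟨hv, hv'⟩
      simp [hXZ] at this
    simp only [mem_inside, mem_union, mem_sdiff] at *
    grind

/-- A largest tight subset of `U` through `v` absorbs, by uncrossing, every tight subset of `U` that
it meets. -/
lemma exists_mem_sup_tight (hH : Sparse p m H) (U : Finset α) {v : α} (hv : v ∈ U) :
    ∃ Z, Tight p m H Z ∧ v ∈ Z ∧ Z ⊆ U ∧
      ∀ Y, Tight p m H Y → Y ⊆ U → (∃ w ∈ Y, w ∈ Z) → Y ⊆ Z := by
  classical
  obtain ⟨Z, hZ, hmax⟩ := exists_max_image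
    (U.powerset.filter fun T => Tight p m H T ∧ v ∈ T) card
    ⟨{v}, by simp [hv, hH.tight_singleton v]⟩
  simp only [mem_filter, mem_powerset] at hZ hmax
  refine ⟨Z, hZ.2.1, hZ.2.2, hZ.1, fun Y hY hYU ⟨w, hwY, hwZ⟩ => ?_⟩
  have h := hmax (Z ∪ Y) ⟨union_subset hZ.1 hYU, hH.tight_union hZ.2.1 hY hwZ hwY,
    mem_union_left _ hZ.2.2⟩
  have := eq_of_subset_of_card_le subset_union_left h
  rw [this]
  exact subset_union_right

/-- If every edge of `E` inside `U` and outside the sparse set `H` has its ends in a tight subset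
of `U`, then the maximal tight subsets of `U` form a partition of `U` attaining the rank of the
edges inside `U`. -/
lemma Sparse.exists_partition {E : Finset β} (hH : Sparse p m H) (hHE : H ⊆ E) (U : Finset α)
    (hU : ∀ e ∈ inside p E U, e ∉ H → ∃ Z ⊆ U, Tight p m H Z ∧ (p e).1 ∈ Z ∧ (p e).2 ∈ Z) :
    ∃ c : α → Finset α, m * #(U.image c) + #(inside p H U) =
      m * #U + #((inside p E U).filter fun e => c (p e).1 ≠ c (p e).2) := by
  classical
  choose! c hc1 hc2 hc3 hc4 using fun v (hv : v ∈ U) => exists_mem_sup_tight hH U hv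
  have hceq : ∀ v ∈ U, ∀ w ∈ U, (c w = c v ↔ w ∈ c v) := fun v hv w hw => by
    refine ⟨fun h => h ▸ hc2 w hw, fun h => ?_⟩
    refine subset_antisymm ?_ ?_
    · exact hc4 v hv _ (hc1 w hw) (hc3 w hw) ⟨w, hc2 w hw, h⟩
    · exact hc4 w hw _ (hc1 v hv) (hc3 v hv) ⟨w, h, hc2 w hw⟩
  refine ⟨c, ?_⟩
  have hfib : ∀ Z ∈ U.image c, U.filter (fun v => c v = Z) = Z := fun Z hZ => by
    obtain ⟨v, hv, rfl⟩ := mem_image.1 hZ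
    ext w
    rw [mem_filter]
    exact ⟨fun h => (hceq v hv w h.1).1 h.2, fun h => ⟨hc3 v hv h, (hceq v hv w (hc3 v hv h)).2 h⟩⟩
  have hcardU : #U = ∑ Z ∈ U.image c, #Z := by
    rw [card_eq_sum_card_fiberwise (f := c) (t := U.image c) fun v hv => mem_image_of_mem c hv]
    exact sum_congr rfl fun Z hZ => by rw [hfib Z hZ]
  have hin : #((inside p H U).filter fun e => c (p e).1 = c (p e).2) =
      ∑ Z ∈ U.image c, #(inside p H Z) := by
    rw [card_eq_sum_card_fiberwise (f := fun e => c (p e).1) (t := U.image c) fun e he =>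
      mem_image_of_mem c (mem_inside.1 (mem_filter.1 he).1).2.1]
    refine sum_congr rfl fun Z hZ => ?_
    congr 1
    ext e
    have h := hfib Z hZ
    have h1 : ∀ v, v ∈ Z ↔ v ∈ U ∧ c v = Z := fun v => by conv_lhs => rw [← h, mem_filter]
    simp only [mem_filter, mem_inside, h1]
    grind
  -- An edge of `E` between different blocks lies in `H`, since the ends of any other edge share a
  -- tight subset of `U`.
  have hcut : (inside p E U).filter (fun e => c (p e).1 ≠ c (p e).2) =
      (inside p H U).filter fun e => ¬ c (p e).1 = c (p e).2 := by
    ext e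
    simp only [mem_filter]
    constructor
    · rintro ⟨h1, h2⟩
      refine ⟨?_, h2⟩
      by_contra hn
      have hn : e ∉ H := fun h => hn (mem_inside.2 ⟨h, (mem_inside.1 h1).2⟩)
      obtain ⟨Z, hZU, hZ, hx, hy⟩ := hU e h1 hn
      have hxU := hZU hx
      have hyU := hZU hy
      have := hc4 _ hxU Z hZ hZU ⟨_, hx, hc2 _ hxU⟩
      exact h2 ((hceq _ hxU _ hyU).2 (this hy)).symm
    · rintro ⟨h1, h2⟩
      exact ⟨inside_mono_left hHE h1, h2⟩
  have hsum : ∑ Z ∈ U.image c, #(inside p H Z) + m * #(U.image c) = m * #U := by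
    rw [hcardU, mul_sum, mul_comm m, ← smul_eq_mul, ← sum_const, ← sum_add_distrib]
    refine sum_congr rfl fun Z hZ => ?_
    obtain ⟨v, hv, rfl⟩ := mem_image.1 hZ
    exact (hc1 v hv).2
  have hsplit := card_filter_add_card_filter_not (s := inside p H U)
    (fun e => c (p e).1 = c (p e).2)
  rw [hcut]
  omega

end

/-! ### Decomposition of sparse sets into forests by exchange sequences. -/

section

variable {H K : Finset β} {X Y Z T U : Finset α} {e f : β}

lemma Sparse.tight_inter_of_inside (hH : Sparse p m H) (hX : Tight p m H X)
    (hU : (X ∩ U).Nonempty) (h : ∀ e ∈ H, (p e).1 ∈ U ∧ (p e).2 ∈ U) : Tight p m H (X ∩ U) := by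
  have h1 : inside p H X ⊆ inside p H (X ∩ U) := fun e he => by
    rw [mem_inside] at he
    have := h e he.1
    simp only [mem_inside, mem_inter]
    tauto
  have h2 := card_le_card h1
  have h3 := hH _ hU
  have h4 := Nat.mul_le_mul_left m (card_le_card (inter_subset_left : X ∩ U ⊆ X))
  have h5 := hX.2
  exact ⟨hU, by omega⟩

/-- The edges of `H` other than `a` having colour `i`. -/
def colorClass (H : Finset β) (s : β × (β → Fin m)) (i : Fin m) : Finset β :=
  (H.erase s.1).filter fun e => s.2 e = i

/-- From a colouring of `H \ {a}`, give `a` the colour `i` and uncolour an edge `f` of the cycle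
that `a` closes in the forest of colour `i`. -/
def ExchangeStep (p : β → α × α) (H : Finset β) (s s' : β × (β → Fin m)) : Prop :=
  ∃ i T, Tight p 1 (colorClass H s i) T ∧ (p s.1).1 ∈ T ∧ (p s.1).2 ∈ T ∧
    (∀ Y, Tight p 1 (colorClass H s i) Y → (p s.1).1 ∈ Y → (p s.1).2 ∈ Y → T ⊆ Y) ∧
    s'.1 ∈ inside p (colorClass H s i) T ∧ s'.2 = Function.update s.2 s.1 i

lemma mem_colorClass {s : β × (β → Fin m)} {i : Fin m} :
    e ∈ colorClass H s i ↔ e ≠ s.1 ∧ e ∈ H ∧ s.2 e = i := by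
  simp [colorClass, and_assoc]

lemma colorClass_update_self {a f : β} {φ : β → Fin m} {i : Fin m} (ha : a ∈ H)
    (hf : f ∈ colorClass H (a, φ) i) :
    colorClass H (f, Function.update φ a i) i = insert a ((colorClass H (a, φ) i).erase f) := by
  ext e
  rw [mem_colorClass] at hf
  simp only [mem_colorClass, mem_insert, mem_erase, Function.update_apply]
  grind

lemma colorClass_update_of_ne {a f : β} {φ : β → Fin m} {i j : Fin m} (hij : j ≠ i)
    (hf : f ∈ colorClass H (a, φ) i) :
    colorClass H (f, Function.update φ a i) j = colorClass H (a, φ) j := by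
  ext e
  rw [mem_colorClass] at hf
  simp only [mem_colorClass, Function.update_apply]
  grind

/-- If `H` has no colouring by forests, then the uncoloured edge of a colouring closes a cycle of each
colour, within every set `D` containing all edges which an exchange can uncolour. -/
lemma exists_tight_inter {D : Finset β} {s : β × (β → Fin m)} {i : Fin m}
    (hs : ∀ i, Sparse p 1 (colorClass H s i))
    (hno : ¬∃ φ : β → Fin m, ∀ i, Sparse p 1 (H.filter fun e => φ e = i))
    (hD : ∀ s', ExchangeStep p H s s' → s'.1 ∈ D) :
    ∃ T, Tight p 1 (colorClass H s i ∩ D) T ∧ (p s.1).1 ∈ T ∧ (p s.1).2 ∈ T := by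
  have h : ∃ X, Tight p 1 (colorClass H s i) X ∧ (p s.1).1 ∈ X ∧ (p s.1).2 ∈ X := by
    refine (hs i).exists_tight_of_not_sparse_insert fun hins => hno
      ⟨Function.update s.2 s.1 i, fun j => ?_⟩
    by_cases hj : j = i
    · subst hj
      refine hins.mono fun e he => ?_
      simp only [mem_filter, mem_insert, mem_colorClass, Function.update_apply] at *
      grind
    · refine (hs j).mono fun e he => ?_
      simp only [mem_filter, mem_colorClass, Function.update_apply] at *
      grind
  obtain ⟨X, hX, hx, hy⟩ := h
  obtain ⟨T, hT, hxT, hyT, hmin⟩ := (hs i).exists_minimal_tight hX hx hy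
  -- Each edge spanned by the smallest tight set can be uncoloured by one exchange, so it lies in
  -- `D` and the restriction to `D` loses none of them.
  refine ⟨T, ⟨hT.1, ?_⟩, hxT, hyT⟩
  rw [← hT.2]
  congr 2
  ext e
  simp only [mem_inside, mem_inter]
  refine ⟨fun h => ⟨h.1.1, h.2⟩, fun h => ⟨⟨h.1, ?_⟩, h.2⟩⟩
  exact hD (e, Function.update s.2 s.1 i)
    ⟨i, T, hT, hxT, hyT, hmin, mem_inside.2 h, rfl⟩

lemma tight_insert_erase (he : e ∉ K) (hf : f ∈ K)
    (h : ((p e).1 ∈ X ∧ (p e).2 ∈ X) ↔ ((p f).1 ∈ X ∧ (p f).2 ∈ X)) :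
    Tight p m (insert e (K.erase f)) X ↔ Tight p m K X := by
  have : #(inside p (insert e (K.erase f)) X) = #(inside p K X) := by
    by_cases hX : (p e).1 ∈ X ∧ (p e).2 ∈ X
    · rw [inside_insert hX, card_insert_of_notMem]
      · have : inside p (K.erase f) X = (inside p K X).erase f := by
          ext g
          simp only [mem_inside, mem_erase]
          tauto
        rw [this, card_erase_add_one (mem_inside.2 ⟨hf, h.1 hX⟩)]
      · simp [mem_inside, he]
    · rw [inside_insert_of_not hX, inside_congr]
      intro g hg1 hg2
      rw [mem_erase]
      refine ⟨fun h => h.2, fun hg => ⟨?_, hg⟩⟩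
      rintro rfl
      exact hX (h.2 ⟨hg1, hg2⟩)
  rw [Tight, Tight, this]

lemma ExchangeStep.valid {s s' : β × (β → Fin m)} (h : ExchangeStep p H s s') (hsH : s.1 ∈ H)
    (hs : ∀ i, Sparse p 1 (colorClass H s i)) :
    s'.1 ∈ H ∧ ∀ i, Sparse p 1 (colorClass H s' i) := by
  obtain ⟨i, T, hT, hx, hy, hmin, hf, h2⟩ := h
  obtain ⟨a, φ⟩ := s
  obtain ⟨f, φ'⟩ := s'
  dsimp only at *
  subst h2
  have hf' := inside_subset hf
  refine ⟨(mem_colorClass.1 hf').2.1, fun j => ?_⟩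
  by_cases hj : j = i
  · subst hj
    rw [colorClass_update_self hsH hf']
    exact (hs _).exchange hmin hf
  · rw [colorClass_update_of_ne hj hf']
    exact hs j

/-- Connections within `D` can be pulled back along an exchange. The swapped edges both have their
ends in `T`, so a tight set is enlarged by `T` if it meets `T`, and is unaffected by the swap
otherwise. -/
lemma ExchangeStep.exists_tight {D : Finset β} {s s' : β × (β → Fin m)}
    (h : ExchangeStep p H s s') (hsH : s.1 ∈ H) (hs : ∀ i, Sparse p 1 (colorClass H s i))
    (hD : ∀ s', ExchangeStep p H s s' → s'.1 ∈ D) (hsD : s.1 ∈ D) {j : Fin m}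
    (hX : Tight p 1 (colorClass H s' j ∩ D) X) :
    ∃ Y, Tight p 1 (colorClass H s j ∩ D) Y ∧ X ⊆ Y := by
  have hs' := (h.valid hsH hs).2
  obtain ⟨i, T, hT, hx, hy, hmin, hf, h2⟩ := h
  obtain ⟨a, φ⟩ := s
  obtain ⟨f, φ'⟩ := s'
  dsimp only at *
  subst h2
  have hf' := inside_subset hf
  by_cases hj : j = i
  · subst hj
    have hTD : Tight p 1 (colorClass H (a, φ) j ∩ D) T := by
      refine ⟨hT.1, ?_⟩
      rw [← hT.2]
      congr 2
      ext e
      simp only [mem_inside, mem_inter]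
      refine ⟨fun h => ⟨h.1.1, h.2⟩, fun h => ⟨⟨h.1, ?_⟩, h.2⟩⟩
      exact hD (e, Function.update φ a j)
        ⟨j, T, hT, hx, hy, hmin, mem_inside.2 h, rfl⟩
    have hfD : f ∈ D := hD (f, Function.update φ a j) ⟨j, T, hT, hx, hy, hmin, hf, rfl⟩
    have heq : colorClass H (f, Function.update φ a j) j ∩ D =
        insert a ((colorClass H (a, φ) j ∩ D).erase f) := by
      rw [colorClass_update_self hsH hf']
      ext e
      simp only [mem_inter, mem_insert, mem_erase]
      grind
    have ha : a ∉ colorClass H (a, φ) j ∩ D := by simp [mem_colorClass]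
    have hfm : f ∈ colorClass H (a, φ) j ∩ D := mem_inter.2 ⟨hf', hfD⟩
    have hfT := (mem_inside.1 hf).2
    have hsp : Sparse p 1 (colorClass H (f, Function.update φ a j) j ∩ D) :=
      (hs' j).mono inter_subset_left
    by_cases hXT : ∃ w ∈ X, w ∈ T
    · obtain ⟨w, hwX, hwT⟩ := hXT
      have hTD' : Tight p 1 (colorClass H (f, Function.update φ a j) j ∩ D) T := by
        rw [heq, tight_insert_erase ha hfm (by tauto)]
        exact hTD
      have hu := hsp.tight_union hX hTD' hwX hwT
      refine ⟨X ∪ T, ?_, subset_union_left⟩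
      rw [heq, tight_insert_erase ha hfm] at hu
      · exact hu
      · simp only [mem_union]
        tauto
    · refine ⟨X, ?_, subset_rfl⟩
      rw [heq, tight_insert_erase ha hfm] at hX
      · exact hX
      · constructor
        · exact fun h => (hXT ⟨_, h.1, hx⟩).elim
        · exact fun h => (hXT ⟨_, h.1, hfT.1⟩).elim
  · rw [colorClass_update_of_ne hj hf'] at hX
    exact ⟨X, hX, subset_rfl⟩

/-- A tight set cannot be split by a set `Y` which no edge leaves. -/
lemma tight_subset_of_closed {K' : Finset β} (hK' : Sparse p m K') (hm : 1 ≤ m)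
    (hX : Tight p m K' X)
    (hclosed : ∀ e ∈ K', ((p e).1 ∈ Y ↔ (p e).2 ∈ Y)) {v : α} (hv : v ∈ X) (hvY : v ∈ Y) :
    X ⊆ Y := by
  rw [← sdiff_eq_empty_iff_subset]
  by_contra hne
  have h1 := hK' (X ∩ Y) ⟨v, mem_inter.2 ⟨hv, hvY⟩⟩
  have h2 := hK' (X \ Y) (nonempty_iff_ne_empty.2 hne)
  have h3 : inside p K' X ⊆ inside p K' (X ∩ Y) ∪ inside p K' (X \ Y) := fun e he => by
    have he' := mem_inside.1 he
    have := hclosed e he'.1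
    simp only [mem_union, mem_inside, mem_inter, mem_sdiff]
    tauto
  have h4 := (card_le_card h3).trans (card_union_le _ _)
  have h5 := hX.2
  have h6 := congrArg (m * ·) (card_inter_add_card_sdiff X Y)
  simp only [mul_add] at h6
  omega

/-- If no colouring exists, let `D` be the edges that exchanges can leave uncoloured. Already in the
initial colouring, each colour restricted to `D` connects the ends of every edge of `D`. Hence all
colours have the same component `W` through an end of `a`, and `W` spans `m (|W| - 1)` coloured
edges besides `a`, contradicting sparsity. -/
lemma Sparse.exists_coloring_insert (hm : 1 ≤ m) {a : β} (ha : a ∉ K)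
    (hH : Sparse p m (insert a K))
    (φ : β → Fin m) (hφ : ∀ i, Sparse p 1 (K.filter fun e => φ e = i)) :
    ∃ φ : β → Fin m, ∀ i, Sparse p 1 ((insert a K).filter fun e => φ e = i) := by
  classical
  by_contra hno
  set H := insert a K with hHdef
  have hcc : ∀ i, colorClass H (a, φ) i = K.filter fun e => φ e = i := fun i => by
    simp [colorClass, hHdef, erase_insert ha]
  let Reach := Relation.ReflTransGen (ExchangeStep p H (m := m)) (a, φ)
  let D := H.filter fun e => ∃ ψ, Reach (e, ψ)
  have haH : a ∈ H := mem_insert_self _ _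
  have hvalid : ∀ s, Reach s → s.1 ∈ H ∧ ∀ i, Sparse p 1 (colorClass H s i) := fun s hs => by
    induction hs with
    | refl => exact ⟨haH, fun i => by rw [hcc]; exact hφ i⟩
    | tail _ hst ih => exact hst.valid ih.1 ih.2
  have hmemD : ∀ s, Reach s → s.1 ∈ D := fun s hs =>
    mem_filter.2 ⟨(hvalid s hs).1, s.2, hs⟩
  have hstepD : ∀ s, Reach s → ∀ s', ExchangeStep p H s s' → s'.1 ∈ D :=
    fun s hs s' hss' => hmemD s' (hs.tail hss')
  have hback : ∀ s, Reach s → ∀ j X, Tight p 1 (colorClass H s j ∩ D) X →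
      ∃ Y, Tight p 1 (colorClass H (a, φ) j ∩ D) Y ∧ X ⊆ Y := fun s hs => by
    induction hs with
    | refl => exact fun j X hX => ⟨X, hX, subset_rfl⟩
    | tail hs hst ih =>
      intro j X hX
      obtain ⟨Y, hY, hXY⟩ := hst.exists_tight (hvalid _ hs).1 (hvalid _ hs).2 (hstepD _ hs)
        (hmemD _ hs) hX
      obtain ⟨Y', hY', hYY'⟩ := ih j Y hY
      exact ⟨Y', hY', hXY.trans hYY'⟩
  -- The vertex type may be infinite; `U` is a finite ambient set in which maximal tight sets exist.
  let U := H.image (fun e => (p e).1) ∪ H.image (fun e => (p e).2)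
  have hU : ∀ e ∈ H, (p e).1 ∈ U ∧ (p e).2 ∈ U := fun e he =>
    ⟨mem_union_left _ (mem_image_of_mem (fun e => (p e).1) he),
      mem_union_right _ (mem_image_of_mem (fun e => (p e).2) he)⟩
  let F := fun i => colorClass H (a, φ) i ∩ D
  have hFD : ∀ i, F i ⊆ D := fun i => inter_subset_right
  have hDH : D ⊆ H := filter_subset _ _
  have hF : ∀ i, Sparse p 1 (F i) := fun i =>
    ((hvalid _ Relation.ReflTransGen.refl).2 i).mono inter_subset_left
  have htight : ∀ i, ∀ e ∈ D, ∃ T, Tight p 1 (F i) T ∧ T ⊆ U ∧ (p e).1 ∈ T ∧ (p e).2 ∈ T := by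
    intro i e he
    obtain ⟨heH, ψ, hψ⟩ := mem_filter.1 he
    obtain ⟨T, hT, hx, hy⟩ := exists_tight_inter (i := i) (hvalid _ hψ).2 hno
      (hstepD _ hψ)
    obtain ⟨Y, hY, hTY⟩ := hback _ hψ i T hT
    have hxU := mem_inter.2 ⟨hTY hx, (hU e heH).1⟩
    have hyU := mem_inter.2 ⟨hTY hy, (hU e heH).2⟩
    exact ⟨Y ∩ U, (hF i).tight_inter_of_inside hY ⟨_, hxU⟩ fun g hg => hU g (hDH (hFD i hg)),
      inter_subset_right, hxU, hyU⟩
  have haD : a ∈ D := hmemD (a, φ) Relation.ReflTransGen.refl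
  choose W hW1 hW2 hW3 hW4 using fun i => exists_mem_sup_tight (hF i) U (hU a haH).1
  have hclosed : ∀ i, ∀ e ∈ D, ((p e).1 ∈ W i ↔ (p e).2 ∈ W i) := fun i e he => by
    obtain ⟨T, hT, hTU, hx, hy⟩ := htight i e he
    exact ⟨fun h => hW4 i T hT hTU ⟨_, hx, h⟩ hy, fun h => hW4 i T hT hTU ⟨_, hy, h⟩ hx⟩
  -- No edge of `D` leaves `W j`, and `W i` is connected by edges of `D`.
  have hsub : ∀ i j, W i ⊆ W j := fun i j =>
    tight_subset_of_closed (hF i) le_rfl (hW1 i) (fun e he => hclosed j e (hFD i he)) (hW2 i)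
      (hW2 j)
  let i₀ : Fin m := ⟨0, hm⟩
  have hWeq : ∀ i, W i = W i₀ := fun i => subset_antisymm (hsub _ _) (hsub _ _)
  have haW : (p a).1 ∈ W i₀ ∧ (p a).2 ∈ W i₀ := ⟨hW2 i₀, (hclosed i₀ a haD).1 (hW2 i₀)⟩
  have h1 := hH (W i₀) ⟨_, haW.1⟩
  have h2 : inside p H (W i₀) = insert a (inside p K (W i₀)) := inside_insert haW
  rw [h2, card_insert_of_notMem (fun h => ha (inside_subset h)),
    card_eq_sum_card_fiberwise (f := φ) (t := univ) (fun _ _ => by simp)] at h1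
  have h3 : ∀ i : Fin m, #(W i₀) ≤ #((inside p K (W i₀)).filter fun e => φ e = i) + 1 := by
    intro i
    have h := (hW1 i).2
    rw [hWeq i, one_mul] at h
    rw [← h]
    refine Nat.add_le_add_right (card_le_card fun e he => ?_) 1
    rw [mem_inside, mem_inter, hcc, mem_filter] at he
    exact mem_filter.2 ⟨mem_inside.2 ⟨he.1.1.1, he.2⟩, he.1.1.2⟩
  have h4 := sum_le_sum fun i (_ : i ∈ (univ : Finset (Fin m))) => h3 i
  simp only [sum_const, sum_add_distrib, card_univ, Fintype.card_fin, smul_eq_mul, mul_one] at h4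
  omega

/-- **Nash-Williams' arboricity theorem**: an `m`-sparse edge set is a union of `m` forests. -/
theorem Sparse.exists_coloring (hm : 1 ≤ m) (hH : Sparse p m H) :
    ∃ φ : β → Fin m, ∀ i, Sparse p 1 (H.filter fun e => φ e = i) := by
  induction H using Finset.induction_on with
  | empty => exact ⟨fun _ => ⟨0, hm⟩, fun i => by simpa using sparse_empty⟩
  | insert a K ha ih =>
    obtain ⟨φ, hφ⟩ := ih (hH.mono (subset_insert _ _))
    exact hH.exists_coloring_insert hm ha φ hφ

end

/-! ### Full-size sparse sets with bounded degrees. -/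

section

variable {E H H' H'' K : Finset β} {V X Y Z T U S : Finset α} {e f : β} {v x y z : α}

/-- The number of edges of `H` incident with `v`. -/
def deg (p : β → α × α) (H : Finset β) (v : α) : ℕ :=
  #(H.filter fun e => (p e).1 = v ∨ (p e).2 = v)

lemma deg_insert_erase_le : deg p (insert e (H.erase f)) v ≤ deg p H v + 1 := by
  refine le_trans (card_le_card ?_) (card_insert_le e _)
  intro g hg
  simp only [mem_filter, mem_insert, mem_erase] at *
  tauto

lemma deg_insert_erase_le_of_not (he : ¬((p e).1 = v ∨ (p e).2 = v)) :
    deg p (insert e (H.erase f)) v ≤ deg p H v := by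
  refine card_le_card fun g hg => ?_
  simp only [mem_filter, mem_insert, mem_erase] at *
  grind

lemma deg_insert_erase_lt (he : ¬((p e).1 = v ∨ (p e).2 = v)) (hfH : f ∈ H)
    (hf : (p f).1 = v ∨ (p f).2 = v) :
    deg p (insert e (H.erase f)) v < deg p H v := by
  refine card_lt_card (ssubset_iff_of_subset ?_ |>.2 ⟨f, mem_filter.2 ⟨hfH, hf⟩, ?_⟩)
  · intro g hg
    simp only [mem_filter, mem_insert, mem_erase] at *
    grind
  · simp only [mem_filter, mem_insert, mem_erase]
    grind

/-- Handshaking for the vertices of `S`. -/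
lemma sum_deg_add_card_inside (hV : ∀ e ∈ H, (p e).1 ∈ V ∧ (p e).2 ∈ V)
    (hloop : ∀ e ∈ H, (p e).1 ≠ (p e).2) :
    ∑ v ∈ S, deg p H v + #(inside p H (V \ S)) = #H + #(inside p H S) := by
  simp only [deg, inside, card_filter, card_eq_sum_ones H]
  -- Edge by edge: the number of ends in `S`, plus one if there is none, equals one, plus one if
  -- both ends are in `S`.
  rw [sum_comm, ← sum_add_distrib, ← sum_add_distrib]
  refine sum_congr rfl fun e he => ?_
  have h1 : ∀ v ∈ S, (if (p e).1 = v ∨ (p e).2 = v then 1 else 0) =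
      (if (p e).1 = v then 1 else 0) + (if (p e).2 = v then 1 else 0) := fun v _ => by
    have := hloop e he
    split_ifs <;> grind
  rw [sum_congr rfl h1, sum_add_distrib, sum_ite_eq, sum_ite_eq]
  have := hV e he
  simp only [mem_sdiff, this, true_and]
  split_ifs <;> grind

/-- `H'` is a sparse subset of `E` which arises from `H` by a change within the edges inside `Z`,
with `Z` tight. -/
structure LocalChange (p : β → α × α) (m : ℕ) (E H : Finset β) (Z : Finset α) (H' : Finset β) :
    Prop where
  subset : H' ⊆ E
  sparse : Sparse p m H'
  tight : Tight p m H' Z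
  mem_iff : ∀ e, ¬((p e).1 ∈ Z ∧ (p e).2 ∈ Z) → (e ∈ H' ↔ e ∈ H)

namespace LocalChange

lemma refl (hE : H ⊆ E) (hH : Sparse p m H) (hZ : Tight p m H Z) : LocalChange p m E H Z H :=
  ⟨hE, hH, hZ, fun _ _ => Iff.rfl⟩

lemma deg_eq (h : LocalChange p m E H Z H') (hv : v ∉ Z) : deg p H' v = deg p H v := by
  unfold deg
  congr 1
  ext e
  simp only [mem_filter]
  refine and_congr_left fun hev => h.mem_iff e ?_
  rintro ⟨h1, h2⟩
  rcases hev with rfl | rfl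
  · exact hv h1
  · exact hv h2

/-- Tightness of `Z` before and after fixes the number of edges inside `Z`; the other edges do not
change. -/
lemma card_inside_eq (h : LocalChange p m E H Z H') (hZ : Tight p m H Z) (hZX : Z ⊆ X) :
    #(inside p H' X) = #(inside p H X) := by
  have key : ∀ K : Finset β, #(inside p K X) =
      #(inside p K Z) + #((inside p K X).filter fun e => ¬((p e).1 ∈ Z ∧ (p e).2 ∈ Z)) := by
    intro K
    rw [← card_filter_add_card_filter_not (s := inside p K X)
      (fun e => (p e).1 ∈ Z ∧ (p e).2 ∈ Z)]
    congr 2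
    ext e
    simp only [mem_filter, mem_inside]
    exact ⟨fun h => ⟨h.1.1, h.2⟩, fun h => ⟨⟨h.1, hZX h.2.1, hZX h.2.2⟩, h.2⟩⟩
  rw [key H', key H]
  have h1 := h.tight.2
  have h2 := hZ.2
  have h3 : (inside p H' X).filter (fun e => ¬((p e).1 ∈ Z ∧ (p e).2 ∈ Z)) =
      (inside p H X).filter fun e => ¬((p e).1 ∈ Z ∧ (p e).2 ∈ Z) := by
    ext e
    simp only [mem_filter, mem_inside]
    have := h.mem_iff e
    tauto
  rw [h3]
  omega

lemma tight_iff (h : LocalChange p m E H Z H') (hZ : Tight p m H Z) (hZX : Z ⊆ X) :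
    Tight p m H' X ↔ Tight p m H X := by
  rw [Tight, Tight, h.card_inside_eq hZ hZX]

lemma tight_of_disjoint (h : LocalChange p m E H Z H') (hXZ : Disjoint X Z)
    (hX : Tight p m H X) : Tight p m H' X := by
  rw [Tight, inside_congr (K := H)]
  · exact hX
  · intro e he1 he2
    exact h.mem_iff e fun hz => (Finset.disjoint_left.1 hXZ he1 hz.1).elim

lemma replace (hE : H ⊆ E) (hH : Sparse p m H) (hZ : Tight p m H Z)
    (hK : LocalChange p m E K Z H') :
    LocalChange p m E H Z (H \ inside p H Z ∪ inside p H' Z) where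
  subset := union_subset (sdiff_subset.trans hE) (inside_subset.trans hK.subset)
  sparse := hH.replace hZ hK.sparse
  tight := by
    rw [Tight, inside_congr (K := H')]
    · exact hK.tight
    · intro e h1 h2
      simp [mem_inside, h1, h2]
  mem_iff := fun e he => by simp [mem_inside, he]

end LocalChange

lemma mem_replace_iff (h : (p e).1 ∈ Z ∧ (p e).2 ∈ Z) :
    e ∈ H \ inside p H Z ∪ inside p K Z ↔ e ∈ K := by
  simp [mem_inside, h]

/-- If every partition of `V` has enough cross edges, then some `m`-sparse edge set has the full size
`m (|V| - 1)`. -/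
lemma exists_base (hV : ∀ e ∈ E, (p e).1 ∈ V ∧ (p e).2 ∈ V) (hne : V.Nonempty)
    (hpart : ∀ c : α → Finset α, m * #(V.image c) ≤
      m + #((inside p E V).filter fun e => c (p e).1 ≠ c (p e).2)) :
    ∃ H ⊆ E, Sparse p m H ∧ #H + m = m * #V := by
  classical
  obtain ⟨H, hH, hmax⟩ := exists_max_image (E.powerset.filter fun H => Sparse p m H) card
    ⟨∅, by simp [sparse_empty]⟩
  simp only [mem_filter, mem_powerset] at hH hmax
  have hHV : inside p H V = H :=
    filter_true_of_mem fun e he => hV e (hH.1 he)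
  obtain ⟨c, hc⟩ := hH.2.exists_partition hH.1 V fun e he heH => by
    have he' := mem_inside.1 he
    obtain ⟨X, hX, hx, hy⟩ := hH.2.exists_tight_of_not_sparse_insert (e := e) fun h => by
      have := hmax (insert e H) ⟨insert_subset he'.1 hH.1, h⟩
      rw [card_insert_of_notMem heH] at this
      omega
    have hxV := mem_inter.2 ⟨hx, he'.2.1⟩
    exact ⟨X ∩ V, inter_subset_right, hH.2.tight_inter_of_inside hX ⟨_, hxV⟩
      fun g hg => hV g (hH.1 hg), hxV, mem_inter.2 ⟨hy, he'.2.2⟩⟩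
  have h1 := hpart c
  have h2 := hH.2 V hne
  rw [hHV] at hc h2
  exact ⟨H, hH.1, hH.2, by omega⟩

/-- Every tight set that meets `S` contains a vertex of `S` whose degree cannot be lowered by a
change within that tight set which creates no excess over `f`. -/
def Locked (p : β → α × α) (m : ℕ) (E : Finset β) (V : Finset α) (f : α → ℕ) (H : Finset β)
    (S : Finset α) : Prop :=
  ∀ Z ⊆ V, Tight p m H Z → (∃ w ∈ Z, w ∈ S) → ∃ z ∈ Z, z ∈ S ∧ ∀ H', LocalChange p m E H Z H' →
    (∀ v ∈ Z, deg p H' v ≤ max (f v) (deg p H v)) → deg p H z ≤ deg p H' z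

/-- Only tight sets that avoid `S` and contain `x` need a new witness. On these there is no excess,
so the allowed maximum of `g` and the old degree is just `g`. -/
lemma locked_insert {g : α → ℕ} (hS : Locked p m E V g H S)
    (hle : ∀ v ∈ V, v ∉ S → deg p H v ≤ g v) (hxg : deg p H x ≤ g x)
    (hx : ∀ Z ⊆ V, Tight p m H Z → Disjoint Z S → x ∈ Z → ∀ H', LocalChange p m E H Z H' →
      (∀ v ∈ Z, deg p H' v ≤ g v) → g x ≤ deg p H' x) :
    Locked p m E V g H (insert x S) := by
  intro Z hZV hZ hZS
  by_cases h : ∃ w ∈ Z, w ∈ S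
  · obtain ⟨z, hzZ, hzS, hz⟩ := hS Z hZV hZ h
    exact ⟨z, hzZ, mem_insert_of_mem hzS, hz⟩
  · obtain ⟨w, hwZ, hwS⟩ := hZS
    have hwx : w = x := (mem_insert.1 hwS).resolve_right fun h' => h ⟨w, hwZ, h'⟩
    subst hwx
    refine ⟨w, hwZ, hwS, fun H' hH' hd => hxg.trans ?_⟩
    refine hx Z hZV hZ (disjoint_left.2 fun v hv hv' => h ⟨v, hv, hv'⟩) hwZ H' hH' fun v hv => ?_
    have := hd v hv
    rwa [max_eq_left (hle v (hZV hv) fun hv' => h ⟨v, hv, hv'⟩)] at this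

/-- The exchange argument: an edge outside `H` whose ends can be relieved locally has its ends in
a tight set avoiding a locked set. -/
lemma Locked.exists_tight {g : α → ℕ} (hH : Sparse p m H) (hm : 1 ≤ m)
    (hV : Tight p m H V) (hS : Locked p m E V g H S)
    (hxV : (p e).1 ∈ V) (hyV : (p e).2 ∈ V) (heE : e ∈ E) (heH : e ∉ H)
    (hx : (p e).1 ∉ S) (hy : (p e).2 ∉ S)
    (hfree : ∀ x ∈ V, x ∉ S → ∃ Z ⊆ V, Tight p m H Z ∧ Disjoint Z S ∧ x ∈ Z ∧
      ∃ H', LocalChange p m E H Z H' ∧ (∀ v ∈ Z, deg p H' v ≤ g v) ∧ deg p H' x < g x) :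
    ∃ Z ⊆ V \ S, Tight p m H Z ∧ (p e).1 ∈ Z ∧ (p e).2 ∈ Z := by
  set x := (p e).1 with hxdef
  set y := (p e).2 with hydef
  obtain ⟨T, hT, hxT, hyT, hTmin⟩ := hH.exists_minimal_tight hV hxV hyV
  have hTV := hTmin V hV hxV hyV
  by_cases hTS : Disjoint T S
  · exact ⟨T, fun v hv => mem_sdiff.2 ⟨hTV hv, disjoint_left.1 hTS hv⟩, hT, hxT, hyT⟩
  exfalso
  obtain ⟨w, hwT, hwS⟩ := not_disjoint_iff.1 hTS
  obtain ⟨Zx, hZxV, hZx, hZxS, hxZx, Hx, hHx, hHxle, hHxlt⟩ := hfree x hxV hx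
  obtain ⟨Zy, hZyV, hZy, hZyS, hyZy, Hy, hHy, hHyle, hHylt⟩ := hfree y hyV hy
  -- If they met, their union would be tight and contain both ends of `e`, hence contain `T` and its
  -- vertex `w` of `S`.
  have hdisj : Disjoint Zy Zx := by
    rw [disjoint_left]
    intro v hvy hvx
    have h := hTmin _ (hH.tight_union hZx hZy hvx hvy) (mem_union_left _ hxZx)
      (mem_union_right _ hyZy) hwT
    rcases mem_union.1 h with h | h
    · exact disjoint_left.1 hZxS h hwS
    · exact disjoint_left.1 hZyS h hwS
  have hxZy : x ∉ Zy := fun h => disjoint_left.1 hdisj h hxZx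
  have hyZx : y ∉ Zx := disjoint_left.1 hdisj hyZy
  have hZyHx : Tight p m Hx Zy := hHx.tight_of_disjoint hdisj hZy
  -- Both relieving changes are carried out at once, leaving room for one more edge at each end of
  -- `e`.
  obtain ⟨K, hKdef⟩ : ∃ K, K = Hx \ inside p Hx Zy ∪ inside p Hy Zy := ⟨_, rfl⟩
  have hK : LocalChange p m E Hx Zy K :=
    hKdef ▸ LocalChange.replace hHx.subset hHx.sparse hZyHx hHy
  have hKmem : ∀ a, ¬((p a).1 ∈ Zx ∧ (p a).2 ∈ Zx) → ¬((p a).1 ∈ Zy ∧ (p a).2 ∈ Zy) →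
      (a ∈ K ↔ a ∈ H) := fun a h1 h2 => (hK.mem_iff a h2).trans (hHx.mem_iff a h1)
  have hKtight : ∀ X, Zx ⊆ X → Zy ⊆ X → (Tight p m K X ↔ Tight p m H X) := fun X h1 h2 =>
    (hK.tight_iff hZyHx h2).trans (hHx.tight_iff hZx h1)
  have hKZx : Tight p m K Zx := hK.tight_of_disjoint hdisj.symm hHx.tight
  have hdx : ∀ v ∈ Zx, deg p K v = deg p Hx v := fun v hv =>
    hK.deg_eq fun h => disjoint_left.1 hdisj h hv
  have hdy : ∀ v ∈ Zy, deg p K v = deg p Hy v := fun v hv => by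
    unfold deg
    congr 1
    ext a
    simp only [mem_filter]
    refine and_congr_left fun hav => ?_
    by_cases ha : (p a).1 ∈ Zy ∧ (p a).2 ∈ Zy
    · rw [hKdef]
      exact mem_replace_iff ha
    · rw [hHy.mem_iff a ha]
      refine hKmem a (fun h => ?_) ha
      rcases hav with rfl | rfl
      · exact disjoint_left.1 hdisj hv h.1
      · exact disjoint_left.1 hdisj hv h.2
  have hdz : ∀ v, v ∉ Zx → v ∉ Zy → deg p K v = deg p H v := fun v h1 h2 =>
    (hK.deg_eq h2).trans (hHx.deg_eq h1)
  have hW : Tight p m H (T ∪ Zx ∪ Zy) :=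
    hH.tight_union (hH.tight_union hT hZx hxT hxZx) hZy (mem_union_left _ hyT) hyZy
  obtain ⟨W, hWdef⟩ : ∃ W, W = T ∪ Zx ∪ Zy := ⟨_, rfl⟩
  rw [← hWdef] at hW
  have hTW : T ⊆ W := by grind
  have hZxW : Zx ⊆ W := by grind
  have hZyW : Zy ⊆ W := by grind
  have hWV : W ⊆ V := hWdef ▸ union_subset (union_subset hTV hZxV) hZyV
  obtain ⟨z, hzW, hzS, hz⟩ := hS W hWV hW ⟨w, hTW hwT, hwS⟩
  have hzx : z ∉ Zx := fun h => disjoint_left.1 hZxS h hzS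
  have hzy : z ∉ Zy := fun h => disjoint_left.1 hZyS h hzS
  have hzT : z ∈ T := by grind
  have hKW : Tight p m K W := (hKtight W hZxW hZyW).2 hW
  obtain ⟨T', hT', hxT', hyT', hT'min⟩ := hK.sparse.exists_minimal_tight hKW (hTW hxT) (hTW hyT)
  have hT'W : T' ⊆ W := hT'min W hKW (hTW hxT) (hTW hyT)
  -- Tight sets containing `Zx` and `Zy` are the same for `K` and `H`, so `T' ∪ Zx ∪ Zy` contains
  -- `T`. An edge at `z` spanned by `T'` can then be traded for `e`, lowering the degree of the
  -- locked vertex `z`.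
  have hzT' : z ∈ T' := by
    have h1 := hK.sparse.tight_union (hK.sparse.tight_union hT' hKZx hxT' hxZx) hK.tight
      (mem_union_left _ hyT') hyZy
    rw [hKtight _ (by grind) (by grind)] at h1
    have := hTmin _ h1 (by grind) (by grind) hzT
    grind
  have hxz : x ≠ z := fun h => hx (h ▸ hzS)
  have hyz : y ≠ z := fun h => hy (h ▸ hzS)
  obtain ⟨f, hf, hfz⟩ := hK.sparse.exists_incident hm hT' hxT' hzT' hxz
  have hfK := (mem_inside.1 hf).1
  have heK : e ∉ K := by
    rw [hKmem e (fun h => hyZx h.2) (fun h => hxZy h.1)]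
    exact heH
  have hfW : (p f).1 ∈ W ∧ (p f).2 ∈ W :=
    ⟨hT'W (mem_inside.1 hf).2.1, hT'W (mem_inside.1 hf).2.2⟩
  have hloc : LocalChange p m E H W (insert e (K.erase f)) :=
    { subset := insert_subset heE ((erase_subset _ _).trans hK.subset)
      sparse := hK.sparse.exchange hT'min hf
      tight := (tight_insert_erase heK hfK ⟨fun _ => hfW, fun _ => ⟨hTW hxT, hTW hyT⟩⟩).2 hKW
      mem_iff := fun a ha => by
        have hae : a ≠ e := by
          rintro rfl
          exact ha ⟨hTW hxT, hTW hyT⟩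
        have haf : a ≠ f := by
          rintro rfl
          exact ha hfW
        rw [mem_insert, mem_erase, ← hKmem a (fun h => ha ⟨hZxW h.1, hZxW h.2⟩)
          (fun h => ha ⟨hZyW h.1, hZyW h.2⟩)]
        simp [hae, haf] }
  have hlt : deg p (insert e (K.erase f)) z < deg p K z :=
    deg_insert_erase_lt (by rintro (h | h) <;> contradiction) hfK hfz
  rw [hdz z hzx hzy] at hlt
  refine absurd (hz _ hloc fun v hv => ?_) (not_le.2 hlt)
  by_cases hvx : v = x
  · subst hvx
    refine le_max_of_le_left (deg_insert_erase_le.trans ?_)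
    rw [hdx _ hxZx]
    exact hHxlt
  by_cases hvy : v = y
  · subst hvy
    refine le_max_of_le_left (deg_insert_erase_le.trans ?_)
    rw [hdy _ hyZy]
    exact hHylt
  refine (deg_insert_erase_le_of_not (by rintro (h | h) <;> simp_all)).trans ?_
  by_cases hvZx : v ∈ Zx
  · exact le_max_of_le_left (by rw [hdx v hvZx]; exact hHxle v hvZx)
  by_cases hvZy : v ∈ Zy
  · exact le_max_of_le_left (by rw [hdy v hvZy]; exact hHyle v hvZy)
  exact le_max_of_le_right (hdz v hvZx hvZy).le

/-- A sparse edge set of full size with bounded degrees. -/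
theorem exists_sparse_deg_le {g : α → ℕ} (hm : 1 ≤ m)
    (hV : ∀ e ∈ E, (p e).1 ∈ V ∧ (p e).2 ∈ V) (hloop : ∀ e ∈ E, (p e).1 ≠ (p e).2)
    (hne : V.Nonempty)
    (hpart₀ : ∀ c : α → Finset α, m * #(V.image c) ≤
      m + #((inside p E V).filter fun e => c (p e).1 ≠ c (p e).2))
    (hpart : ∀ S ⊆ V, S.Nonempty → ∀ c : α → Finset α, m * #((V \ S).image c) + 2 * m * #S ≤
      ∑ v ∈ S, g v + 2 * m + #((inside p E (V \ S)).filter fun e => c (p e).1 ≠ c (p e).2)) :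
    ∃ H ⊆ E, Sparse p m H ∧ #H + m = m * #V ∧ ∀ v ∈ V, deg p H v ≤ g v := by
  classical
  obtain ⟨H₀, hH₀⟩ := exists_base hV hne hpart₀
  obtain ⟨H, hH, hmin⟩ := exists_min_image
    (E.powerset.filter fun H => Sparse p m H ∧ #H + m = m * #V)
    -- Truncated subtraction: only the excess over `g` is counted.
    (fun H => ∑ v ∈ V, (deg p H v - g v)) ⟨H₀, by simpa using hH₀⟩
  simp only [mem_filter, mem_powerset] at hH hmin
  obtain ⟨hHE, hHs, hHc⟩ := hH
  refine ⟨H, hHE, hHs, hHc, ?_⟩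
  by_contra! hex
  obtain ⟨v₀, hv₀V, hv₀⟩ := hex
  have hin : ∀ K ⊆ E, inside p K V = K := fun K hK => filter_true_of_mem fun e he => hV e (hK he)
  have hVt : Tight p m H V := ⟨hne, by rw [hin H hHE]; exact hHc⟩
  let S₀ := V.filter fun v => g v < deg p H v
  have hS₀ : Locked p m E V g H S₀ := by
    intro Z hZV hZ ⟨z, hzZ, hzS⟩
    refine ⟨z, hzZ, hzS, fun H' hH' hd => ?_⟩
    by_contra! hlt
    have hcard : #H' + m = m * #V := by
      have := hH'.card_inside_eq hZ hZV
      rw [hin _ hHE, hin _ hH'.subset] at this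
      rw [this, hHc]
    refine absurd (hmin H' ⟨hH'.subset, hH'.sparse, hcard⟩) (not_le.2 ?_)
    refine sum_lt_sum (fun v hv => ?_) ⟨z, hZV hzZ, ?_⟩
    · by_cases hvZ : v ∈ Z
      · have := hd v hvZ
        omega
      · rw [hH'.deg_eq hvZ]
    · have := (mem_filter.1 hzS).2
      omega
  -- The condition `g ≤ deg` on `S` makes the excess at one vertex survive in the sum over `S`;
  -- maximality makes every vertex outside `S` relievable.
  obtain ⟨S, hS, hmax⟩ := exists_max_image
    (V.powerset.filter fun S => S₀ ⊆ S ∧ Locked p m E V g H S ∧ ∀ v ∈ S, g v ≤ deg p H v) card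
    ⟨S₀, by
      simp only [mem_filter, mem_powerset]
      exact ⟨filter_subset _ _, subset_rfl, hS₀, fun v hv => (mem_filter.1 hv).2.le⟩⟩
  simp only [mem_filter, mem_powerset] at hS hmax
  obtain ⟨hSV, hS₀S, hSl, hSg⟩ := hS
  have hle : ∀ v ∈ V, v ∉ S → deg p H v ≤ g v := fun v hv hvS => by
    by_contra! h
    exact hvS (hS₀S (mem_filter.2 ⟨hv, h⟩))
  have hfree : ∀ x ∈ V, x ∉ S → ∃ Z ⊆ V, Tight p m H Z ∧ Disjoint Z S ∧ x ∈ Z ∧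
      ∃ H', LocalChange p m E H Z H' ∧ (∀ v ∈ Z, deg p H' v ≤ g v) ∧ deg p H' x < g x := by
    intro x hxV hxS
    by_contra! hno
    -- The trivial change on the tight set `{x}` is one of those excluded by `hno`.
    have hgx : g x ≤ deg p H x := by
      refine hno {x} (by simpa using hxV) (hHs.tight_singleton x) (by simpa using hxS)
        (mem_singleton_self x) H (.refl hHE hHs (hHs.tight_singleton x)) fun v hv => ?_
      rw [mem_singleton.1 hv]
      exact hle x hxV hxS
    have := hmax (insert x S) ⟨insert_subset hxV hSV, hS₀S.trans (subset_insert _ _),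
      locked_insert hSl hle (hle x hxV hxS) hno, fun v hv => by
        rcases mem_insert.1 hv with rfl | hv
        · exact hgx
        · exact hSg v hv⟩
    rw [card_insert_of_notMem hxS] at this
    omega
  obtain ⟨c, hc⟩ := hHs.exists_partition hHE (V \ S) fun e he heH => by
    obtain ⟨heE, hx, hy⟩ := mem_inside.1 he
    rw [mem_sdiff] at hx hy
    exact hSl.exists_tight hHs hm hVt hx.1 hy.1 heE heH hx.2 hy.2 hfree
  have hv₀S : v₀ ∈ S := hS₀S (mem_filter.2 ⟨hv₀V, hv₀⟩)
  -- Handshaking, sparsity on `S` and the partition identity bound the degree sum over `S` by `2m|S|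
  -- - 2m + m * blocks - cross edges`, hence by the sum of `g`.
  have h1 := hpart S hSV ⟨v₀, hv₀S⟩ c
  have h2 := sum_deg_add_card_inside (S := S) (fun e he => hV e (hHE he))
    (fun e he => hloop e (hHE he))
  have h3 := hHs S ⟨v₀, hv₀S⟩
  have h4 : ∑ v ∈ S, g v < ∑ v ∈ S, deg p H v := sum_lt_sum hSg ⟨v₀, hv₀S, hv₀⟩
  have h5 := congrArg (m * ·) (card_sdiff_add_card_eq_card hSV)
  simp only [mul_add] at h5
  rw [mul_assoc] at h1
  omega

end

/-! ### From toughness to partitions, through a Caro–Wei bound. -/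

section

variable {E H K : Finset β} {V X Y D U S : Finset α} {e f : β} {v x y z : α}

/-- The vertices of `D` joined to `v` by an edge of `E`. -/
def nbrs (p : β → α × α) (E : Finset β) (D : Finset α) (v : α) : Finset α :=
  D.filter fun w => ∃ e ∈ E, ((p e).1 = v ∧ (p e).2 = w) ∨ ((p e).2 = v ∧ (p e).1 = w)

lemma card_nbrs_le (hv : v ∈ D) : #(nbrs p E D v) ≤ deg p (inside p E D) v := by
  refine le_trans (card_le_card fun w hw => ?_)
    (card_image_le (f := fun e => if (p e).1 = v then (p e).2 else (p e).1))
  obtain ⟨hwD, e, he, h⟩ := mem_filter.1 hw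
  refine mem_image.2 ⟨e, mem_filter.2 ⟨mem_inside.2 ⟨he, ?_⟩, ?_⟩, ?_⟩
  · rcases h with ⟨rfl, rfl⟩ | ⟨rfl, rfl⟩ <;> exact ⟨by assumption, by assumption⟩
  · tauto
  · split_ifs <;> grind

/-- A bound of Caro–Wei type for the largest independent subset of `D`. -/
lemma exists_independent (m : ℕ) (hloop : ∀ e ∈ E, (p e).1 ≠ (p e).2) (D : Finset α) :
    ∃ I ⊆ D, (∀ e ∈ E, ¬((p e).1 ∈ I ∧ (p e).2 ∈ I)) ∧
      2 * (m + 1) * #D ≤ (m + 1) * (m + 2) * #I + 2 * #(inside p E D) := by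
  induction D using Finset.strongInduction with
  | H D ih =>
  rcases D.eq_empty_or_nonempty with rfl | hne
  · exact ⟨∅, by simp⟩
  -- Greedy choice: take a vertex with fewest neighbours, `d` of them, and delete its closed
  -- neighbourhood `C`; at least `d (d + 1) / 2` edges disappear.
  obtain ⟨v, hv, hmin⟩ := exists_min_image D (fun v => #(nbrs p E D v)) hne
  obtain ⟨C, hC⟩ : ∃ C, C = insert v (nbrs p E D v) := ⟨_, rfl⟩
  have hCD : C ⊆ D := hC ▸ insert_subset hv (filter_subset _ _)
  have hvN : v ∉ nbrs p E D v := fun h => by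
    obtain ⟨-, e, he, h | h⟩ := mem_filter.1 h
    · exact hloop e he (h.1.trans h.2.symm)
    · exact hloop e he (h.2.trans h.1.symm)
  have hvC : v ∈ C := hC ▸ mem_insert_self _ _
  obtain ⟨I, hID, hI, hcard⟩ := ih (D \ C) (sdiff_ssubset hCD ⟨v, hvC⟩)
  have hvI : v ∉ I := fun h => (mem_sdiff.1 (hID h)).2 hvC
  have hNI : ∀ w ∈ I, w ∉ nbrs p E D v := fun w hw h =>
    (mem_sdiff.1 (hID hw)).2 (hC ▸ mem_insert_of_mem h)
  refine ⟨insert v I, insert_subset hv (hID.trans sdiff_subset), fun e he ⟨h1, h2⟩ => ?_, ?_⟩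
  · rw [mem_insert] at h1 h2
    rcases h1 with h1 | h1 <;> rcases h2 with h2 | h2
    · exact hloop e he (h1.trans h2.symm)
    · exact hNI _ h2 (mem_filter.2 ⟨(mem_sdiff.1 (hID h2)).1, e, he, Or.inl ⟨h1, rfl⟩⟩)
    · exact hNI _ h1 (mem_filter.2 ⟨(mem_sdiff.1 (hID h1)).1, e, he, Or.inr ⟨h2, rfl⟩⟩)
    · exact hI e he ⟨h1, h2⟩
  · have hcC : #C = #(nbrs p E D v) + 1 := by rw [hC, card_insert_of_notMem hvN]
    obtain ⟨d, hd⟩ : ∃ d, d = #(nbrs p E D v) := ⟨_, rfl⟩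
    rw [← hd] at hcC hmin
    have h1 := sum_deg_add_card_inside (p := p) (H := inside p E D) (V := D) (S := C)
      (fun e he => (mem_inside.1 he).2) (fun e he => hloop e (mem_inside.1 he).1)
    have h2 : #C * d ≤ ∑ w ∈ C, deg p (inside p E D) w := by
      rw [← smul_eq_mul]
      exact card_nsmul_le_sum _ _ _ fun w hw => (hmin w (hCD hw)).trans (card_nbrs_le (hCD hw))
    have h3 : ∀ X ⊆ D, inside p (inside p E D) X = inside p E X := fun X hX =>
      inside_congr fun e he1 he2 => by simp [mem_inside, hX he1, hX he2]
    rw [h3 _ sdiff_subset, h3 _ hCD] at h1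
    have h4 : #(inside p E C) + #(inside p E (D \ C)) ≤ #(inside p E D) := by
      rw [← card_union_of_disjoint]
      · exact card_le_card
          (union_subset (inside_mono_right hCD) (inside_mono_right sdiff_subset))
      · rw [disjoint_left]
        intro e h h'
        exact (mem_sdiff.1 (mem_inside.1 h').2.1).2 (mem_inside.1 h).2.1
    have h5 := card_sdiff_add_card_eq_card hCD
    rw [card_insert_of_notMem hvI, ← h5, hcC]
    rw [hcC] at h2
    -- The difference of the two sides is `(m - d) (m - d + 1)`, a product of consecutive integers.
    have h6 : 2 * (m + 1) * (d + 1) ≤ (m + 1) * (m + 2) + (d + 1) * d := by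
      rcases le_or_gt d m with h | h
      · obtain ⟨k, rfl⟩ := Nat.exists_eq_add_of_le h
        nlinarith
      · obtain ⟨k, rfl⟩ := Nat.exists_eq_add_of_lt h
        nlinarith
    nlinarith

/-- A toughness condition counting components and isolated vertices gives a lower bound on the
number of cross edges of every partition of `V \ S`. -/
theorem card_image_le_of_tough (hloop : ∀ e ∈ E, (p e).1 ≠ (p e).2)
    {γ : Type*} [DecidableEq γ] (c : α → γ)
    (htough : ∀ S ⊆ V, ∀ I ⊆ V \ S,
      (∀ e ∈ inside p E (V \ S), c (p e).1 = c (p e).2) →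
      (∀ e ∈ inside p E (V \ S), (p e).1 ∉ I ∧ (p e).2 ∉ I) →
      m * (m + 1) * #I + 2 * m * #((V \ S).image c) ≤ 2 * #S + 2 * m)
    (hS : S ⊆ V) :
    m * #((V \ S).image c) ≤
      #S + m + #((inside p E (V \ S)).filter fun e => c (p e).1 ≠ c (p e).2) := by
  classical
  obtain ⟨n, hn⟩ : ∃ n, n = #(V \ S) := ⟨_, rfl⟩
  induction n generalizing S with
  | zero =>
    have : V \ S = ∅ := card_eq_zero.1 hn.symm
    simp [this]
  | succ n ih =>
  -- If an end of a cross edge shares its block, moving it into `S` keeps the number of blocks, adds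
  -- one to `|S|` and destroys at least one cross edge.
  by_cases hcase : ∃ e ∈ inside p E (V \ S), c (p e).1 ≠ c (p e).2 ∧
      ∃ x ∈ V \ S, (x = (p e).1 ∨ x = (p e).2) ∧ ∃ y ∈ V \ S, y ≠ x ∧ c y = c x
  · obtain ⟨e, he, hce, x, hx, hxe, y, hy, hyx, hcy⟩ := hcase
    have hxVS := mem_sdiff.1 hx
    have hsd : V \ insert x S = (V \ S).erase x := by
      ext w
      simp only [mem_sdiff, mem_insert, mem_erase]
      tauto
    have h := ih (S := insert x S) (insert_subset hxVS.1 hS) (by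
      rw [hsd, card_erase_of_mem hx, ← hn]; rfl)
    have himg : (V \ insert x S).image c = (V \ S).image c := by
      refine subset_antisymm (image_subset_image (by rw [hsd]; exact erase_subset _ _)) ?_
      intro a ha
      obtain ⟨w, hw, rfl⟩ := mem_image.1 ha
      by_cases hwx : w = x
      · rw [hwx, ← hcy]
        exact mem_image_of_mem c (by rw [hsd]; exact mem_erase.2 ⟨hyx, hy⟩)
      · exact mem_image_of_mem c (by rw [hsd]; exact mem_erase.2 ⟨hwx, hw⟩)
    have hcut : #((inside p E (V \ insert x S)).filter fun e => c (p e).1 ≠ c (p e).2) <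
        #((inside p E (V \ S)).filter fun e => c (p e).1 ≠ c (p e).2) := by
      refine card_lt_card ((ssubset_iff_of_subset ?_).2 ⟨e, mem_filter.2 ⟨he, hce⟩, ?_⟩)
      · exact filter_subset_filter _ (inside_mono_right (by rw [hsd]; exact erase_subset _ _))
      · simp only [mem_filter, mem_inside, hsd, mem_erase]
        rcases hxe with rfl | rfl <;> simp
    rw [himg, card_insert_of_notMem hxVS.2] at h
    omega
  · push Not at hcase
    -- The vertices in singleton blocks; now the cross edges are exactly the edges inside `D`.
    let D := (V \ S).filter fun v => ∀ w ∈ V \ S, c w = c v → w = v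
    have hDU : D ⊆ V \ S := filter_subset _ _
    have hD : (inside p E (V \ S)).filter (fun e => c (p e).1 ≠ c (p e).2) = inside p E D := by
      ext e
      simp only [mem_filter]
      constructor
      · rintro ⟨he, hce⟩
        have he' := mem_inside.1 he
        refine mem_inside.2 ⟨he'.1, mem_filter.2 ⟨he'.2.1, fun w hw hc => ?_⟩,
          mem_filter.2 ⟨he'.2.2, fun w hw hc => ?_⟩⟩
        · by_contra hne
          exact hcase e he hce _ he'.2.1 (Or.inl rfl) w hw hne hc
        · by_contra hne
          exact hcase e he hce _ he'.2.2 (Or.inr rfl) w hw hne hc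
      · intro he
        have he' := mem_inside.1 he
        refine ⟨inside_mono_right hDU he, fun hc => ?_⟩
        exact hloop e he'.1 ((mem_filter.1 he'.2.2).2 _ (hDU he'.2.1) hc)
    obtain ⟨I, hID, hI, hcard⟩ := exists_independent m hloop D
    have hDIV : D \ I ⊆ V := sdiff_subset.trans (hDU.trans sdiff_subset)
    have hsub : V \ (S ∪ D \ I) ⊆ V \ S := sdiff_subset_sdiff subset_rfl subset_union_left
    have hconst : ∀ e ∈ inside p E (V \ (S ∪ D \ I)), c (p e).1 = c (p e).2 := by
      intro e he
      by_contra hce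
      have heD : e ∈ inside p E D := by
        rw [← hD]
        exact mem_filter.2 ⟨inside_mono_right hsub he, hce⟩
      have h1 := mem_inside.1 he
      have h2 := mem_inside.1 heD
      refine hI e h1.1 ⟨?_, ?_⟩
      · have := h1.2.1
        simp only [mem_sdiff, mem_union] at this
        tauto
      · have := h1.2.2
        simp only [mem_sdiff, mem_union] at this
        tauto
    -- Deleting `D \ I` as well removes every cross edge and isolates the vertices of `I`, at the
    -- cost of at most `|D \ I|` blocks.
    have h := htough (S ∪ D \ I) (union_subset hS hDIV) I (fun v hv => by
        have := mem_sdiff.1 (hDU (hID hv))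
        simp only [mem_sdiff, mem_union]
        tauto) hconst (fun e he => by
        have hc := hconst e he
        have he' := mem_inside.1 he
        exact ⟨fun h => hloop e he'.1
            ((mem_filter.1 (hID h)).2 _ (hsub he'.2.2) hc.symm).symm,
          fun h => hloop e he'.1 ((mem_filter.1 (hID h)).2 _ (hsub he'.2.1) hc)⟩)
    have himg : #((V \ S).image c) ≤ #((V \ (S ∪ D \ I)).image c) + #(D \ I) := by
      refine le_trans (card_le_card (t := (V \ (S ∪ D \ I)).image c ∪ (D \ I).image c) ?_)
        ((card_union_le _ _).trans (Nat.add_le_add_left card_image_le _))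
      rw [← image_union]
      refine image_subset_image fun v hv => ?_
      simp only [mem_sdiff, mem_union] at *
      tauto
    have hSD : #(S ∪ D \ I) ≤ #S + #(D \ I) := card_union_le _ _
    have hDI := card_sdiff_add_card_eq_card hID
    rw [hD]
    have := Nat.mul_le_mul_left m himg
    rw [← hDI] at hcard
    nlinarith

end

/-! ### Translation between edge sets and multigraphs. -/

section

variable {G : Graph α β}

/-- The pair `p e` lists the ends of `e`, for every edge `e` of `G`. -/
def IsEnds (p : β → α × α) (G : Graph α β) : Prop :=
  ∀ e ∈ E(G), G.IsLink e (p e).1 (p e).2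

lemma IsEnds.isLink_iff (hp : IsEnds p G) {e : β} {x y : α} :
    G.IsLink e x y ↔ e ∈ E(G) ∧ ((p e).1 = x ∧ (p e).2 = y ∨ (p e).1 = y ∧ (p e).2 = x) := by
  constructor
  · intro h
    exact ⟨h.edge_mem, (hp e h.edge_mem).eq_and_eq_or_eq_and_eq h⟩
  · rintro ⟨he, ⟨rfl, rfl⟩ | ⟨rfl, rfl⟩⟩
    · exact hp e he
    · exact (hp e he).symm

lemma IsEnds.degree_restrict (hp : IsEnds p G) {H : Finset β} (hH : (H : Set β) ⊆ E(G)) (v : α) :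
    (G.restrict H).degree v = deg p H v := by
  rw [Graph.degree, deg, ← Set.ncard_coe_finset]
  congr 1
  ext e
  rw [Graph.mem_incidenceSet, Graph.restrict_inc, mem_coe, mem_coe, mem_filter]
  simp only [Graph.Inc, hp.isLink_iff]
  constructor
  · rintro ⟨⟨y, -, h⟩, he⟩
    tauto
  · rintro ⟨he, h | h⟩
    · exact ⟨⟨(p e).2, hH he, Or.inl ⟨h, rfl⟩⟩, he⟩
    · exact ⟨⟨(p e).1, hH he, Or.inr ⟨rfl, h⟩⟩, he⟩

/-- Sparsity on pairs excludes parallel edges. `V` is tight, so no proper nonempty union of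
components exists, and the edge count then forces a tree. -/
lemma IsEnds.isTree_restrict [G.Loopless] (hp : IsEnds p G) {V : Finset α} (hV : (V : Set α) = V(G))
    (hne : V.Nonempty) {F : Finset β} (hF : (F : Set β) ⊆ E(G)) (hs : Sparse p 1 F)
    (hcard : #F + 1 = #V) : (G.restrict F).IsTree := by
  have hll : (G.restrict (F : Set β)).Loopless := Graph.Loopless.anti (Graph.restrict_le (G := G))
  have hlink : ∀ {e x y}, (G.restrict (F : Set β)).IsLink e x y ↔
      e ∈ F ∧ ((p e).1 = x ∧ (p e).2 = y ∨ (p e).1 = y ∧ (p e).2 = x) := fun {e x y} => by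
    rw [Graph.restrict_isLink, hp.isLink_iff, mem_coe]
    exact ⟨fun h => ⟨h.1, h.2.2⟩, fun h => ⟨h.1, hF h.1, h.2⟩⟩
  have hmemV : ∀ e ∈ F, (p e).1 ∈ V ∧ (p e).2 ∈ V := fun e he => by
    have := hp e (hF he)
    rw [← mem_coe, ← mem_coe, hV]
    exact ⟨this.left_mem, this.right_mem⟩
  have hsimple : (G.restrict (F : Set β)).Simple :=
    { hll with
      eq_of_isLink := fun e f x y he hf => by
        by_contra hef
        have h1 := hs {x, y} ⟨x, by simp⟩
        have h2 : {e, f} ⊆ inside p F {x, y} := fun g hg => by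
          rw [hlink] at he hf
          simp only [mem_insert, mem_singleton, mem_inside] at *
          rcases hg with rfl | rfl <;> tauto
        have h3 := card_le_card h2
        rw [card_pair hef] at h3
        have h4 : #({x, y} : Finset α) ≤ 2 := card_le_two
        omega }
  refine ⟨hsimple, ?_⟩
  have hVG : V(G.restrict (F : Set β)) = V := hV.symm
  have hfin : Finite V(G.restrict (F : Set β)) := by
    rw [hVG]
    infer_instance
  have hcardV : Nat.card V(G.restrict (F : Set β)) = #V := by
    rw [hVG, Nat.card_coe_set_eq, Set.ncard_coe_finset]
  have hconn : (G.restrict (F : Set β)).toSimpleGraph.Connected := by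
    obtain ⟨v, hv⟩ := hne
    have : Nonempty V(G.restrict (F : Set β)) := ⟨⟨v, by rw [hVG]; exact hv⟩⟩
    refine ⟨fun a b => ?_⟩
    classical
    let Y := V.filter fun w => ∃ hw : w ∈ V(G.restrict (F : Set β)),
      (G.restrict (F : Set β)).toSimpleGraph.Reachable a ⟨w, hw⟩
    have hVF : inside p F V = F := filter_true_of_mem hmemV
    have hVt : Tight p 1 F V := ⟨⟨v, hv⟩, by rw [hVF, hcard, one_mul]⟩
    have haV : (a : α) ∈ V := by
      rw [← mem_coe, ← hVG]
      exact a.2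
    have hsub : V ⊆ Y := by
      refine tight_subset_of_closed hs le_rfl hVt (fun e he => ?_) haV
        (mem_filter.2 ⟨haV, a.2, .refl _⟩)
      have hl : (G.restrict (F : Set β)).IsLink e (p e).1 (p e).2 :=
        hlink.2 ⟨he, Or.inl ⟨rfl, rfl⟩⟩
      have hadj : (G.restrict (F : Set β)).toSimpleGraph.Adj ⟨_, hl.left_mem⟩
          ⟨_, hl.right_mem⟩ := by
        rw [Graph.toSimpleGraph_adj_iff]
        exact ⟨e, hl⟩
      simp only [Y, mem_filter, hmemV e he, true_and]
      constructor
      · rintro ⟨hw, h⟩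
        exact ⟨hl.right_mem, h.trans hadj.reachable⟩
      · rintro ⟨hw, h⟩
        exact ⟨hl.left_mem, h.trans hadj.symm.reachable⟩
    have hbV : (b : α) ∈ V := by
      rw [← mem_coe, ← hVG]
      exact b.2
    obtain ⟨-, hw, h⟩ := mem_filter.1 (hsub hbV)
    exact h
  rw [SimpleGraph.isTree_iff_connected_and_card]
  refine ⟨hconn, le_antisymm ?_ hconn.card_vert_le_card_edgeSet_add_one⟩
  rw [hcardV, ← hcard]
  refine Nat.add_le_add_right ?_ 1
  have hex : ∀ z : (G.restrict (F : Set β)).toSimpleGraph.edgeSet, ∃ e : F,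
      ∃ x y : V(G.restrict (F : Set β)), (z : Sym2 _) = s(x, y) ∧
        (G.restrict (F : Set β)).IsLink e x y := by
    rintro ⟨z, hz⟩
    induction z using Sym2.ind with
    | _ x y =>
      rw [SimpleGraph.mem_edgeSet, Graph.toSimpleGraph_adj_iff] at hz
      obtain ⟨e, he⟩ := hz
      exact ⟨⟨e, (hlink.1 he).1⟩, x, y, rfl, he⟩
  choose φ x y hz hφ using hex
  have hinj : Function.Injective φ := fun z z' h => by
    have h1 := hφ z
    have h2 := hφ z'
    rw [h] at h1
    apply Subtype.ext
    rw [hz z, hz z', Sym2.eq_iff]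
    rcases h1.eq_and_eq_or_eq_and_eq h2 with ⟨h3, h4⟩ | ⟨h3, h4⟩
    · exact Or.inl ⟨Subtype.ext h3, Subtype.ext h4⟩
    · exact Or.inr ⟨Subtype.ext h3, Subtype.ext h4⟩
  calc Nat.card _ ≤ Nat.card F := Nat.card_le_card_of_injective φ hinj
    _ = #F := by simp

/-- A sparse edge set of full size is the edge set of an `m`-tree-connected factor. -/
lemma IsEnds.isTreeConnected_restrict [G.Loopless] (hp : IsEnds p G) {V : Finset α}
    (hV : (V : Set α) = V(G)) (hne : V.Nonempty) (hm : 1 ≤ m) {H : Finset β}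
    (hH : (H : Set β) ⊆ E(G)) (hs : Sparse p m H) (hcard : #H + m = m * #V) :
    (G.restrict H).IsTreeConnected m := by
  obtain ⟨φ, hφ⟩ := hs.exists_coloring hm
  have hsub : ∀ i, ((H.filter fun e => φ e = i : Finset β) : Set β) ⊆ H := fun i =>
    coe_subset.2 (filter_subset _ _)
  have hle : ∀ i, #(H.filter fun e => φ e = i) + 1 ≤ #V := fun i => by
    have h := hφ i V hne
    have : inside p (H.filter fun e => φ e = i) V = H.filter fun e => φ e = i :=
      filter_true_of_mem fun e he => by
        have := hp e (hH (hsub i he))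
        rw [← mem_coe, ← mem_coe, hV]
        exact ⟨this.left_mem, this.right_mem⟩
    rwa [this, one_mul] at h
  have hsum : ∑ i, (#(H.filter fun e => φ e = i) + 1) = ∑ i : Fin m, #V := by
    rw [sum_add_distrib, ← card_eq_sum_card_fiberwise (fun _ _ => by simp)]
    simpa using hcard
  -- The `m` forests have at most `|V| - 1` edges each and `m (|V| - 1)` in total, so each attains
  -- the bound.
  have heq := (sum_eq_sum_iff_of_le fun i _ => hle i).1 hsum
  refine ⟨fun i => G.restrict (H.filter fun e => φ e = i : Finset β), fun i => ⟨?_, ?_⟩, ?_⟩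
  · exact { le := Graph.restrict_mono_right G (hsub i), vertexSet_eq := rfl }
  · exact hp.isTree_restrict hV hne ((hsub i).trans hH) (hφ i) (heq i (mem_univ i))
  · intro i j hij
    rw [Set.disjoint_left]
    rintro e ⟨-, he⟩ ⟨-, he'⟩
    rw [mem_coe, mem_filter] at he he'
    exact hij (he.2.symm.trans he'.2)

lemma card_image_le_numComponents (S : Set α) {U : Finset α} (hU : (U : Set α) = V(G) \ S)
    {γ : Type*} [DecidableEq γ] (c : α → γ)
    (hc : ∀ e x y, (G.deleteVerts S).IsLink e x y → c x = c y) :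
    #(U.image c) ≤ (G.deleteVerts S).numComponents := by
  have hVU : V(G.deleteVerts S) = U := by rw [Graph.vertexSet_deleteVerts, hU]
  have hfin : Finite V(G.deleteVerts S) := by
    rw [hVU]
    infer_instance
  have hfin' : Finite (G.deleteVerts S).toSimpleGraph.ConnectedComponent := Quot.finite _
  have hreach : ∀ (a b : V(G.deleteVerts S)) (w : (G.deleteVerts S).toSimpleGraph.Walk a b),
      c a = c b := fun a b w => by
    induction w with
    | nil => rfl
    | cons h _ ih =>
      obtain ⟨-, e, he⟩ := h
      exact (hc e _ _ he).trans ih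
  let φ : (G.deleteVerts S).toSimpleGraph.ConnectedComponent → γ :=
    SimpleGraph.ConnectedComponent.lift (fun v => c v) fun a b w _ => hreach a b w
  have hsub : ((U.image c : Finset γ) : Set γ) ⊆ Set.range φ := by
    intro a ha
    obtain ⟨v, hv, rfl⟩ := mem_image.1 (mem_coe.1 ha)
    exact ⟨(G.deleteVerts S).toSimpleGraph.connectedComponentMk ⟨v, by rw [hVU]; exact hv⟩, rfl⟩
  rw [← Set.ncard_coe_finset]
  refine (Set.ncard_le_ncard hsub (Set.finite_range φ)).trans ?_
  rw [← Nat.card_coe_set_eq]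
  exact Finite.card_range_le φ

lemma card_le_numIsolated (hV : V(G).Finite) (S : Set α) {I : Finset α}
    (hI : (I : Set α) ⊆ V(G) \ S)
    (h : ∀ e x y, (G.deleteVerts S).IsLink e x y → x ∉ I) :
    #I ≤ (G.deleteVerts S).numIsolated := by
  rw [← Set.ncard_coe_finset, Graph.numIsolated]
  refine Set.ncard_le_ncard (fun v hv => ⟨?_, ?_⟩) ?_
  · rw [Graph.vertexSet_deleteVerts]
    exact hI hv
  · rintro w ⟨e, he⟩
    exact h e v w he hv
  · refine hV.subset fun v hv => ?_
    have := hv.1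
    rw [Graph.vertexSet_deleteVerts] at this
    exact this.1

end

end SparseEdges

theorem mainTheorem3 {α β : Type*} (G : Graph α β) [G.Loopless]
    (hV : V(G).Finite) (hE : E(G).Finite) (m : ℕ) (hm : 1 ≤ m)
    (hG : ∀ S : Set α, S ⊆ V(G) →
      ((m : ℝ) + 1) / 2 * ((G.deleteVerts S).numIsolated : ℝ) + ((G.deleteVerts S).numComponents : ℝ)
        ≤ 1 / (m : ℝ) * (S.ncard : ℝ) + 1)
    (u : α) (hu : u ∈ V(G)) :
    ∃ H : Graph α β, H ≤s G ∧ H.IsTreeConnected m ∧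
      (∀ v ∈ V(G), H.degree v ≤ 2 * m + 1) ∧ H.degree u ≤ m + 1 := by
  classical
  obtain ⟨V, hVG⟩ := hV.exists_finset_coe
  obtain ⟨E, hEG⟩ := hE.exists_finset_coe
  have hends : ∀ e ∈ E(G), ∃ q : α × α, G.IsLink e q.1 q.2 := fun e he => by
    obtain ⟨x, y, h⟩ := G.exists_isLink_of_mem_edgeSet he
    exact ⟨(x, y), h⟩
  -- A default pair for labels that are not edges of `G`.
  have : Nonempty (α × α) := ⟨(u, u)⟩
  choose! p hp' using hends
  have hp : SparseEdges.IsEnds p G := hp'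
  have hEV : ∀ e ∈ E, (p e).1 ∈ V ∧ (p e).2 ∈ V := fun e he => by
    have := hp e (hEG ▸ Finset.mem_coe.2 he)
    rw [← Finset.mem_coe, ← Finset.mem_coe, hVG]
    exact ⟨this.left_mem, this.right_mem⟩
  have hloop : ∀ e ∈ E, (p e).1 ≠ (p e).2 := fun e he =>
    (hp e (hEG ▸ Finset.mem_coe.2 he)).ne
  have huV : u ∈ V := by rwa [← Finset.mem_coe, hVG]
  have htough : ∀ (c : α → Finset α), ∀ S ⊆ V, ∀ I ⊆ V \ S,
      (∀ e ∈ SparseEdges.inside p E (V \ S), c (p e).1 = c (p e).2) →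
      (∀ e ∈ SparseEdges.inside p E (V \ S), (p e).1 ∉ I ∧ (p e).2 ∉ I) →
      m * (m + 1) * I.card + 2 * m * ((V \ S).image c).card ≤ 2 * S.card + 2 * m := by
    intro c S hS I hI hc hiso
    have hU : ((V \ S : Finset α) : Set α) = V(G) \ S := by rw [Finset.coe_sdiff, hVG]
    have hin : ∀ e x y, (G.deleteVerts S).IsLink e x y → e ∈ SparseEdges.inside p E (V \ S) ∧
        ((p e).1 = x ∧ (p e).2 = y ∨ (p e).1 = y ∧ (p e).2 = x) := fun e x y h => by
      obtain ⟨hl, hx, hy⟩ := (G.deleteVerts_isLink _).1 h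
      obtain ⟨he, hxy⟩ := hp.isLink_iff.1 hl
      have heE : e ∈ E := by rwa [← Finset.mem_coe, hEG]
      refine ⟨SparseEdges.mem_inside.2 ⟨heE, ?_⟩, hxy⟩
      have := hEV e heE
      rw [Finset.mem_coe] at hx hy
      simp only [Finset.mem_sdiff]
      rcases hxy with ⟨rfl, rfl⟩ | ⟨rfl, rfl⟩ <;> tauto
    have h1 := SparseEdges.card_image_le_numComponents (S : Set α) hU c fun e x y h => by
      obtain ⟨he, ⟨rfl, rfl⟩ | ⟨rfl, rfl⟩⟩ := hin e x y h
      · exact hc e he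
      · exact (hc e he).symm
    have h2 := SparseEdges.card_le_numIsolated hV (S : Set α) (I := I)
      (by rw [← hU]; exact Finset.coe_subset.2 hI) fun e x y h => by
      obtain ⟨he, ⟨rfl, rfl⟩ | ⟨rfl, rfl⟩⟩ := hin e x y h
      · exact (hiso e he).1
      · exact (hiso e he).2
    have h3 := hG S (by rw [← hVG]; exact Finset.coe_subset.2 hS)
    rw [Set.ncard_coe_finset] at h3
    have hm' : (0 : ℝ) < m := by exact_mod_cast hm
    -- Multiplying by `2m` clears both denominators, so the bound can be cast to `ℕ`.
    have h4 : ((m : ℝ) * (m + 1)) * (G.deleteVerts (S : Set α)).numIsolated +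
        2 * m * (G.deleteVerts (S : Set α)).numComponents ≤ 2 * S.card + 2 * m := by
      have h5 := mul_le_mul_of_nonneg_left h3 (by positivity : (0 : ℝ) ≤ 2 * m)
      have h6 : 2 * (m : ℝ) * (1 / m * S.card + 1) = 2 * S.card + 2 * m := by
        field_simp
      linarith
    have h7 : m * (m + 1) * (G.deleteVerts (S : Set α)).numIsolated +
        2 * m * (G.deleteVerts (S : Set α)).numComponents ≤ 2 * S.card + 2 * m := by
      exact_mod_cast h4
    exact le_trans (Nat.add_le_add (Nat.mul_le_mul_left _ h2) (Nat.mul_le_mul_left _ h1)) h7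
  have hpart : ∀ S ⊆ V, ∀ c : α → Finset α, m * ((V \ S).image c).card ≤ S.card + m +
      ((SparseEdges.inside p E (V \ S)).filter fun e => c (p e).1 ≠ c (p e).2).card :=
    fun S hS c => SparseEdges.card_image_le_of_tough hloop c (htough c) hS
  obtain ⟨H, hHE, hHs, hHc, hHd⟩ := SparseEdges.exists_sparse_deg_le
    (g := fun v => if v = u then m + 1 else 2 * m + 1) hm hEV hloop ⟨u, huV⟩
    (fun c => by simpa using hpart ∅ (Finset.empty_subset _) c) (fun S hS hne c => by
      have h1 := hpart S hS c
      -- Lowering the bound at `u` costs at most `m`, exactly the gap between the `m` in `hpart` and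
      -- the `2m` allowed here.
      have h2 : (2 * m + 1) * S.card ≤ ∑ v ∈ S, (if v = u then m + 1 else 2 * m + 1) + m := by
        have h3 : ∀ v ∈ S, 2 * m + 1 =
            (if v = u then m + 1 else 2 * m + 1) + (if v = u then m else 0) := fun v _ => by
          split_ifs <;> omega
        rw [mul_comm, ← smul_eq_mul, ← Finset.sum_const, Finset.sum_congr rfl h3,
          Finset.sum_add_distrib, Finset.sum_ite_eq']
        split_ifs <;> omega
      rw [add_mul, one_mul] at h2
      omega)
  have hHG : (H : Set β) ⊆ E(G) := by rw [← hEG]; exact Finset.coe_subset.2 hHE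
  refine ⟨G.restrict H, { le := Graph.restrict_le, vertexSet_eq := rfl },
    hp.isTreeConnected_restrict hVG ⟨u, huV⟩ hm hHG hHs hHc, fun v hv => ?_, ?_⟩
  · rw [hp.degree_restrict hHG]
    refine (hHd v (by rwa [← Finset.mem_coe, hVG])).trans ?_
    split_ifs <;> omega
  · rw [hp.degree_restrict hHG]
    simpa using hHd u huV
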